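/- Let $R$ be an integral domain with quotient field $K$. For a nonzero $R$-submodule $E$ of $K$ put $(R:E)=\{x\in K: xE\subseteq R\}$, $E_v=(R:(R:E))$ and $E_t=\bigcup J_v$, the union over all nonzero finitely generated submodules $J\subseteq E$. A $t$-ideal of $R$ is a nonzero ideal $I$ of $R$ with $I_t=I$; a $t$-prime is a prime $t$-ideal; a $t$-maximal ideal is a maximal element of the set of proper $t$-ideals (such an ideal is prime). $R$ is a Prüfer $v$-multiplication domain (P$v$MD) if $R_M$ is a valuation domain for each $t$-maximal ideal $M$. $R$ is a $t\#\#$-domain if $\bigcap_{P\in\mathcal P_1}R_P\neq\bigcap_{P\in\mathcal P_2}R_P$ (as subrings of $K$, the empty intersection being $K$) for any two distinct sets $\mathcal P_1,\mathcal P_2$, each consisting of pairwise incomparable $t$-primes. A strong ideal of $R$ is the trace of some $R$-module $M$, that is, the ideal generated by all $f(m)$ with $f\in\operatorname{Hom}_R(M,R)$ and $m\in M$. $R$ is a $tRTP$-domain (it has the $t$-radical trace property) if each proper strong $t$-ideal of $R$ is a radical ideal. A prime ideal $P$ is branched if there is a $P$-primary ideal distinct from $P$. **Theorem.** Let $R$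 be a P$v$MD. (1) If $R$ is a $t\#\#$-domain, then $R$ is a $tRTP$-domain. (2) If $R$ is a $tRTP$-domain and each $t$-prime of $R$ is branched, then $R$ is a $t\#\#$-domain. -/

import Mathlib

universe u v

namespace TIdeal

section Closure

variable {R : Type u} [CommRing R] {K : Type v} [Field K] [Algebra R K]

/-- The divisorial closure `E_v = (R : (R : E))` of an `R`-submodule `E` of `K`. Here `1` is `R`
seen as a submodule of `K`, and `1 / E = {x ∈ K | x E ⊆ R}` is the colon `(R : E)`. -/
noncomputable def vClosure (E : Submodule R K) : Submodule R K :=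
  1 / (1 / E)

theorem vClosure_mono {E F : Submodule R K} (h : E ≤ F) : vClosure E ≤ vClosure F := by
  intro x hx
  rw [vClosure, Submodule.mem_div_iff_forall_mul_mem] at hx ⊢
  intro y hy
  refine hx y ?_
  rw [Submodule.mem_div_iff_forall_mul_mem] at hy ⊢
  exact fun z hz => hy z (h hz)

/-- The `t`-closure `E_t = ⋃ J_v`, the union over all finitely generated submodules `J ⊆ E`.
(The submodule `J = 0` does not change the union when `E ≠ 0`.) -/
noncomputable def tClosure (E : Submodule R K) : Submodule R K where
  carrier := {x | ∃ J : Submodule R K, J.FG ∧ J ≤ E ∧ x ∈ vClosure J}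
  add_mem' := by
    rintro x y ⟨J₁, hJ₁, hE₁, hx⟩ ⟨J₂, hJ₂, hE₂, hy⟩
    exact ⟨J₁ ⊔ J₂, hJ₁.sup hJ₂, sup_le hE₁ hE₂,
      add_mem (vClosure_mono le_sup_left hx) (vClosure_mono le_sup_right hy)⟩
  zero_mem' := ⟨⊥, Submodule.fg_bot, bot_le, zero_mem _⟩
  smul_mem' := by
    rintro r x ⟨J, hJ, hE, hx⟩
    exact ⟨J, hJ, hE, Submodule.smul_mem _ r hx⟩

end Closure

section Ideals

variable {R : Type u} [CommRing R] (K : Type v) [Field K] [Algebra R K]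

/-- A `t`-ideal of `R`: a nonzero ideal `I` with `I_t = I`. -/
def IsTIdeal (I : Ideal R) : Prop :=
  I ≠ ⊥ ∧ tClosure (IsLocalization.coeSubmodule K I) = IsLocalization.coeSubmodule K I

/-- A `t`-prime: a prime `t`-ideal. In particular it is nonzero. -/
def IsTPrime (P : Ideal R) : Prop :=
  IsTIdeal K P ∧ P.IsPrime

/-- A `t`-maximal ideal: an ideal that is maximal among the proper `t`-ideals. -/
def IsTMaximal (M : Ideal R) : Prop :=
  Maximal (fun I : Ideal R => IsTIdeal K I ∧ I ≠ ⊤) M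

end Ideals

section Prime

variable {R : Type u} [CommRing R] {K : Type v} [Field K] [Algebra R K]

theorem le_vClosure (E : Submodule R K) : E ≤ vClosure E := by
  intro x hx
  rw [vClosure, Submodule.mem_div_iff_forall_mul_mem]
  intro y hy
  rw [Submodule.mem_div_iff_forall_mul_mem] at hy
  rw [mul_comm]
  exact hy x hx

theorem vClosure_vClosure (E : Submodule R K) : vClosure (vClosure E) = vClosure E := by
  refine le_antisymm ?_ (le_vClosure _)
  intro x hx
  rw [vClosure, Submodule.mem_div_iff_forall_mul_mem] at hx ⊢
  intro y hy
  refine hx y ?_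
  rw [Submodule.mem_div_iff_forall_mul_mem]
  intro z hz
  rw [vClosure, Submodule.mem_div_iff_forall_mul_mem] at hz
  rw [mul_comm]
  exact hz y hy

theorem le_tClosure (E : Submodule R K) : E ≤ tClosure E := by
  intro x hx
  exact ⟨Submodule.span R {x}, Submodule.fg_span_singleton x,
    (Submodule.span_singleton_le_iff_mem _ _).2 hx,
    le_vClosure _ (Submodule.mem_span_singleton_self x)⟩

theorem tClosure_mono {E F : Submodule R K} (h : E ≤ F) : tClosure E ≤ tClosure F := by
  rintro x ⟨J, hJ, hE, hx⟩
  exact ⟨J, hJ, hE.trans h, hx⟩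

/-- A finitely generated submodule of `E_t` is contained in `J_v` for one finitely generated
`J ⊆ E`. -/
theorem exists_fg_le_vClosure {E L : Submodule R K} (hL : L.FG) (h : L ≤ tClosure E) :
    ∃ J : Submodule R K, J.FG ∧ J ≤ E ∧ L ≤ vClosure J := by
  induction L, hL using Submodule.fg_induction with
  | singleton x =>
    obtain ⟨J, hJ, hE, hx⟩ := h (Submodule.mem_span_singleton_self x)
    exact ⟨J, hJ, hE, (Submodule.span_singleton_le_iff_mem _ _).2 hx⟩
  | sup L₁ L₂ _ _ ih₁ ih₂ =>
    obtain ⟨J₁, h₁, h₁', h₁''⟩ := ih₁ (le_sup_left.trans h)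
    obtain ⟨J₂, h₂, h₂', h₂''⟩ := ih₂ (le_sup_right.trans h)
    exact ⟨J₁ ⊔ J₂, h₁.sup h₂, sup_le h₁' h₂',
      sup_le (h₁''.trans (vClosure_mono le_sup_left)) (h₂''.trans (vClosure_mono le_sup_right))⟩

theorem tClosure_tClosure (E : Submodule R K) : tClosure (tClosure E) = tClosure E := by
  refine le_antisymm ?_ (le_tClosure _)
  rintro x ⟨L, hL, hE, hx⟩
  obtain ⟨J, hJ, hJE, hLJ⟩ := exists_fg_le_vClosure hL hE
  refine ⟨J, hJ, hJE, ?_⟩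
  rw [← vClosure_vClosure J]
  exact vClosure_mono hLJ hx

theorem tClosure_le_one {E : Submodule R K} (h : E ≤ 1) : tClosure E ≤ 1 := by
  rintro x ⟨J, hJ, hE, hx⟩
  rw [vClosure, Submodule.mem_div_iff_forall_mul_mem] at hx
  have := hx 1 (Submodule.one_mem_div.2 (hE.trans h))
  rwa [mul_one] at this

theorem mul_mem_tClosure {E F : Submodule R K} {b x : K} (h : ∀ y ∈ E, b * y ∈ F)
    (hx : x ∈ tClosure E) : b * x ∈ tClosure F := by
  obtain ⟨J, hJ, hE, hx⟩ := hx
  refine ⟨J.map (LinearMap.mulLeft R b), hJ.map _, ?_, ?_⟩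
  · rintro _ ⟨y, hy, rfl⟩
    exact h y (hE hy)
  · rw [vClosure, Submodule.mem_div_iff_forall_mul_mem] at hx ⊢
    intro z hz
    rw [Submodule.mem_div_iff_forall_mul_mem] at hz
    have : x * (b * z) ∈ (1 : Submodule R K) := hx _ (by
      rw [Submodule.mem_div_iff_forall_mul_mem]
      intro y hy
      have := hz (b * y) ⟨y, hy, rfl⟩
      rwa [mul_left_comm, ← mul_assoc] at this)
    rwa [mul_left_comm, ← mul_assoc] at this

/-- The `t`-maximal ideals of a domain are prime. -/
theorem IsTMaximal.isPrime [IsDomain R] [IsFractionRing R K] {M : Ideal R} (hM : IsTMaximal K M) : M.IsPrime := by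
  obtain ⟨⟨⟨hM0, hMt⟩, hM1⟩, hmax⟩ := hM
  refine ⟨hM1, ?_⟩
  intro a b hab
  by_contra! hcon
  obtain ⟨ha, hb⟩ := hcon
  -- `T` is the `t`-closure of `M + aR`, an integral `t`-ideal properly containing `M`
  set E : Submodule R K := IsLocalization.coeSubmodule K (M ⊔ Ideal.span {a}) with hE
  have hE1 : E ≤ 1 := by
    rw [← IsLocalization.coeSubmodule_top]
    exact IsLocalization.coeSubmodule_mono K le_top
  let T : Ideal R := (tClosure E).comap (Algebra.linearMap R K)
  have hT : IsLocalization.coeSubmodule K T = tClosure E := by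
    apply le_antisymm
    · rintro _ ⟨x, hx, rfl⟩
      exact hx
    · intro x hx
      obtain ⟨r, rfl⟩ := Submodule.mem_one.1 (tClosure_le_one hE1 hx)
      exact ⟨r, hx, rfl⟩
  have hET : M ⊔ Ideal.span {a} ≤ T := fun r hr => le_tClosure E ⟨r, hr, rfl⟩
  have haT : a ∈ T := hET (Ideal.mem_sup_right (Ideal.mem_span_singleton_self a))
  have hMT : M ≤ T := le_sup_left.trans hET
  have hTt : IsTIdeal K T := by
    refine ⟨fun h => hM0 (le_bot_iff.1 (h ▸ hMT)), ?_⟩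
    rw [hT, tClosure_tClosure]
  have hTtop : T = ⊤ := by
    by_contra hne
    exact ha (hmax ⟨hTt, hne⟩ hMT haT)
  have h1 : (1 : K) ∈ tClosure E := by
    have : (1 : R) ∈ T := hTtop ▸ Submodule.mem_top
    have h : Algebra.linearMap R K 1 ∈ tClosure E := this
    simpa using h
  have hbE : algebraMap R K b * 1 ∈ tClosure (IsLocalization.coeSubmodule K M) := by
    refine mul_mem_tClosure ?_ h1
    rintro _ ⟨y, hy, rfl⟩
    obtain ⟨m, hm, z, hz, rfl⟩ := Submodule.mem_sup.1 hy
    obtain ⟨c, rfl⟩ := Ideal.mem_span_singleton'.1 hz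
    refine ⟨b * (m + c * a), ?_, by simp⟩
    rw [mul_add]
    refine M.add_mem (M.mul_mem_left _ hm) ?_
    have : b * (c * a) = c * (a * b) := by ring
    rw [this]
    exact M.mul_mem_left _ hab
  rw [mul_one, hMt] at hbE
  obtain ⟨m, hm, hmb⟩ := hbE
  have : m = b := IsFractionRing.injective R K hmb
  exact hb (this ▸ hm)

end Prime

section Domains

variable (R : Type u) [CommRing R] [IsDomain R] (K : Type v) [Field K] [Algebra R K]
  [IsFractionRing R K]

/-- `R` is a Prüfer `v`-multiplication domain: the localization `R_M` at each `t`-maximal ideal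
`M` is a valuation domain. -/
def IsPvMD : Prop :=
  ∀ (M : Ideal R) (hM : IsTMaximal K M),
    haveI : M.IsPrime := hM.isPrime
    ValuationRing (Localization.AtPrime M)

/-- The set of all `t`-prime ideals of `R`. -/
def tSpec : Set (PrimeSpectrum R) :=
  {P | IsTPrime K P.asIdeal}

variable {R} in
/-- The subring `⋂_{P ∈ S} R_P` of `K`; it is `K` for `S = ∅`. -/
noncomputable def localizationInter (S : Set (PrimeSpectrum R)) : Subalgebra R K :=
  ⨅ P ∈ S, Localization.subalgebra.ofField K P.asIdeal.primeCompl
    P.asIdeal.primeCompl_le_nonZeroDivisors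

/-- The `t##`-property: `⋂_{P ∈ S₁} R_P ≠ ⋂_{P ∈ S₂} R_P` for any two distinct sets `S₁`, `S₂`,
each consisting of pairwise incomparable `t`-primes. -/
def IsTSharpSharp : Prop :=
  ∀ S₁ S₂ : Set (PrimeSpectrum R), S₁ ⊆ tSpec R K → S₂ ⊆ tSpec R K →
    IsAntichain (· ≤ ·) S₁ → IsAntichain (· ≤ ·) S₂ →
    S₁ ≠ S₂ → localizationInter K S₁ ≠ localizationInter K S₂

/-- The trace of an `R`-module `M`: the ideal generated by all `f m` with `f : M → R` linear and
`m ∈ M`. -/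
def traceIdeal (M : Type*) [AddCommGroup M] [Module R M] : Ideal R :=
  Ideal.span {r | ∃ (f : M →ₗ[R] R) (m : M), f m = r}

variable {R} in
/-- A strong (or trace) ideal: the trace of some `R`-module. A trace ideal is the trace of itself,
so it does not matter in which universe the modules are taken. -/
def IsStrong (J : Ideal R) : Prop :=
  ∃ (M : Type u) (_ : AddCommGroup M) (_ : Module R M), traceIdeal R M = J

/-- The `t`-radical trace property: each proper strong `t`-ideal is a radical ideal. -/
def IsTRTP : Prop :=
  ∀ J : Ideal R, IsTIdeal K J → IsStrong J → J ≠ ⊤ → J.IsRadical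

variable {R} in
/-- A prime ideal `P` is branched if there is a `P`-primary ideal distinct from `P`. -/
def IsBranched (P : Ideal R) : Prop :=
  ∃ Q : Ideal R, Q.IsPrimary ∧ Q.radical = P ∧ Q ≠ P

end Domains

end TIdeal

/-!
Both parts go through one condition on a `t`-prime `P`, here called sharpness (`IsSharpPrime`): the
intersection of the rings `R_N`, over the `t`-maximal ideals `N` not containing `P`, is not
contained in `R_P`. Every `R_P` at a `t`-prime is a valuation ring, `R` and its `t`-ideals are the
intersections of their localizations at the `t`-maximal ideals (`mem_of_forall_isTMaximal`), and a
nonzero ideal `J` is strong exactly when `(R : J)` stabilizes it (`IsStrong.exists_mem_eq`,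
`isStrong_of_forall_mem`). If `P` is sharp, as witnessed by `y`, then the conductor of `y` is the
inverse of the `t`-invertible module `R + R y`, and this yields a finitely generated ideal `I ⊆ P`
such that every `t`-maximal ideal containing `I` contains `P` (`IsSharpPrime.exists_fg`).

In a `t##`-domain all `t`-primes are sharp, as one sees by adding `P` to the antichain of the
`t`-maximal ideals not containing it. Suppose a strong `t`-ideal `J` is not radical at a
`t`-maximal ideal `M`, and let `P ⊆ M` be a minimal prime of `J`. If `J R_P ≠ P R_P`, pick `x ∈ P`
outside `J R_P` and let `B = I + R x`. Locally at each `t`-maximal ideal `J` is contained in `B` or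
`B` is the unit ideal, so `(R : B) ⊆ (R : J)` stabilizes `J`; then `J R_P` lies in all powers of
`B R_P`, although its radical is `P R_P`. If `J R_P = P R_P`, let `s ∉ P` and `C = I + R s`. Again
`(R : C) ⊆ (R : J)`, and `(R : C)` generates `s⁻¹ R_M` at `M`, so `J R_M` is closed under division
by `s`; hence `J R_M = J R_P = P R_P` is radical.

Conversely, let `Q ≠ P` be primary with radical a `t`-prime `P`. A `t`-maximal ideal contains `Q`
only if it contains `P`, so if `P` is not sharp then `(R : Q) ⊆ R_P`. Since `Q` is contracted from
`R_P`, it is then a strong `t`-ideal that is not radical, against the `t`-radical trace property. So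
all branched `t`-primes are sharp. Adding to `I` an element of `P` outside `Q` produces a finitely
generated ideal contained in exactly those `t`-primes that contain `P`, hence an element of `K` that
lies in `R_{Q'}` for each `t`-prime `Q'` not containing `P`, but not in `R_P`
(`IsSharpPrime.exists_separating`). Two antichains of `t`-primes with the same intersection
therefore refine each other, and so are equal.
-/

namespace TIdeal

/-! ### Primes at which the localization is a valuation ring -/

section Local

variable {R : Type u} [CommRing R]

/-- `R_P` is a valuation ring, expressed inside `R`: of any two elements, one divides the other
after multiplication by an element outside `P`. -/
def IsValuationAt (P : Ideal R) : Prop :=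
  ∀ a b : R, (∃ s ∉ P, a ∣ s * b) ∨ ∃ s ∉ P, b ∣ s * a

theorem IsValuationAt.mono {P M : Ideal R} (hM : IsValuationAt M) (h : P ≤ M) :
    IsValuationAt P := by
  intro a b
  rcases hM a b with ⟨s, hs, hd⟩ | ⟨s, hs, hd⟩
  · exact Or.inl ⟨s, fun hP => hs (h hP), hd⟩
  · exact Or.inr ⟨s, fun hP => hs (h hP), hd⟩

theorem isValuationAt_of_valuationRing [IsDomain R] (P : Ideal R) [P.IsPrime]
    [ValuationRing (Localization.AtPrime P)] : IsValuationAt P := by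
  have key : ∀ a b : R,
      algebraMap R (Localization.AtPrime P) a ∣ algebraMap R (Localization.AtPrime P) b →
      ∃ s ∉ P, a ∣ s * b := by
    rintro a b ⟨c, hc⟩
    obtain ⟨r, s, rfl⟩ := IsLocalization.exists_mk'_eq P.primeCompl c
    refine ⟨s, s.2, r, ?_⟩
    apply IsLocalization.injective (Localization.AtPrime P) P.primeCompl_le_nonZeroDivisors
    rw [map_mul, map_mul, hc, mul_left_comm, IsLocalization.mk'_spec']
  intro a b
  rcases ValuationRing.dvd_total (algebraMap R (Localization.AtPrime P) a)
    (algebraMap R (Localization.AtPrime P) b) with h | h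
  · exact Or.inl (key a b h)
  · exact Or.inr (key b a h)

/-- In a valuation ring `R_N`, the localized prime `P R_N` is divisible by every element
outside `P`. -/
theorem IsValuationAt.exists_dvd_mul {N P : Ideal R} (hN : IsValuationAt N) (hP : P.IsPrime)
    (hPN : P ≤ N) {s j : R} (hs : s ∉ P) (hj : j ∈ P) : ∃ t ∉ N, s ∣ t * j := by
  rcases hN s j with h | ⟨t, ht, r, hr⟩
  · exact h
  · have : t * s ∈ P := hr ▸ P.mul_mem_right r hj
    exact absurd ((hP.mem_or_mem this).resolve_right hs) (fun h => ht (hPN h))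

/-- A finitely generated module over a ring which is a valuation ring at the prime `P` is locally
principal at `P`. -/
theorem IsValuationAt.exists_generator {K : Type v} [Field K] [Algebra R K]
    [IsDomain R] [IsFractionRing R K] {P : Ideal R} (hP : P.IsPrime) (hv : IsValuationAt P)
    {J : Submodule R K} (hJ : J.FG) :
    ∃ b ∈ J, ∃ u ∉ P, ∀ j ∈ J, ∃ r : R, u • j = r • b := by
  induction J, hJ using Submodule.fg_induction with
  | singleton x =>
    refine ⟨x, Submodule.mem_span_singleton_self x, 1, hP.one_notMem, fun j hj => ?_⟩
    obtain ⟨r, rfl⟩ := Submodule.mem_span_singleton.1 hj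
    exact ⟨r, one_smul _ _⟩
  | sup J₁ J₂ _ _ ih₁ ih₂ =>
    obtain ⟨b₁, hb₁, u₁, hu₁, h₁⟩ := ih₁
    obtain ⟨b₂, hb₂, u₂, hu₂, h₂⟩ := ih₂
    -- whichever of `b₁`, `b₂` divides the other locally generates the sum
    have key : ∀ (J J' : Submodule R K) (b b' : K) (u u' s r : R),
        (∀ j ∈ J, ∃ r : R, u • j = r • b) → (∀ j ∈ J', ∃ r : R, u' • j = r • b') →
        s • b' = r • b → ∀ j ∈ J ⊔ J', ∃ r : R, (s * u * u') • j = r • b := by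
      intro J J' b b' u u' s r h h' hs j hj
      obtain ⟨x, hx, y, hy, rfl⟩ := Submodule.mem_sup.1 hj
      obtain ⟨p, hp⟩ := h x hx
      obtain ⟨q, hq⟩ := h' y hy
      refine ⟨s * u' * p + u * q * r, ?_⟩
      simp only [Algebra.smul_def, map_mul, map_add] at *
      linear_combination (algebraMap R K s * algebraMap R K u') * hp +
        (algebraMap R K s * algebraMap R K u) * hq + (algebraMap R K u * algebraMap R K q) * hs
    obtain ⟨c₁, d₁, hd₁, rfl⟩ := IsFractionRing.div_surjective (A := R) b₁
    obtain ⟨c₂, d₂, hd₂, rfl⟩ := IsFractionRing.div_surjective (A := R) b₂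
    have hd₁0 := IsFractionRing.to_map_ne_zero_of_mem_nonZeroDivisors (K := K) hd₁
    have hd₂0 := IsFractionRing.to_map_ne_zero_of_mem_nonZeroDivisors (K := K) hd₂
    rcases hv (c₁ * d₂) (c₂ * d₁) with ⟨s, hs, r, hr⟩ | ⟨s, hs, r, hr⟩
    · refine ⟨_, Submodule.mem_sup_left hb₁, s * u₁ * u₂,
        hP.mul_notMem (hP.mul_notMem hs hu₁) hu₂, key _ _ _ _ u₁ u₂ s r h₁ h₂ ?_⟩
      have := congrArg (algebraMap R K) hr
      simp only [map_mul] at this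
      rw [Algebra.smul_def, Algebra.smul_def]
      field_simp
      linear_combination this
    · refine ⟨_, Submodule.mem_sup_right hb₂, s * u₂ * u₁,
        hP.mul_notMem (hP.mul_notMem hs hu₂) hu₁, ?_⟩
      rw [sup_comm]
      refine key _ _ _ _ u₂ u₁ s r h₂ h₁ ?_
      have := congrArg (algebraMap R K) hr
      simp only [map_mul] at this
      rw [Algebra.smul_def, Algebra.smul_def]
      field_simp
      linear_combination this

theorem IsValuationAt.exists_generator_ideal [IsDomain R] {P : Ideal R} (hP : P.IsPrime)
    (hv : IsValuationAt P) {B : Ideal R} (hB : B.FG) :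
    ∃ b ∈ B, ∃ u ∉ P, ∀ j ∈ B, b ∣ u * j := by
  obtain ⟨_, ⟨b, hb, rfl⟩, u, hu, h⟩ := hv.exists_generator (K := FractionRing R) hP
    (J := IsLocalization.coeSubmodule (FractionRing R) B) (Submodule.FG.map _ hB)
  refine ⟨b, hb, u, hu, fun j hj => ?_⟩
  obtain ⟨r, hr⟩ := h _ ⟨j, hj, rfl⟩
  refine ⟨r, IsFractionRing.injective R (FractionRing R) ?_⟩
  simp only [Algebra.smul_def, Algebra.linearMap_apply] at hr
  rw [map_mul, hr, map_mul, mul_comm]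

end Local

/-! ### `t`-ideals and `t`-maximal ideals -/

section TMaximal

variable {R : Type u} [CommRing R] {K : Type v} [Field K] [Algebra R K]

theorem tClosure_one : tClosure (1 : Submodule R K) = 1 :=
  le_antisymm (tClosure_le_one le_rfl) (le_tClosure _)

theorem coeSubmodule_le_one (I : Ideal R) : IsLocalization.coeSubmodule K I ≤ 1 := by
  rw [← IsLocalization.coeSubmodule_top]
  exact IsLocalization.coeSubmodule_mono K le_top

theorem algebraMap_mem_coeSubmodule [IsDomain R] [IsFractionRing R K] {I : Ideal R} {x : R} :
    algebraMap R K x ∈ IsLocalization.coeSubmodule K I ↔ x ∈ I := by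
  constructor
  · rintro ⟨y, hy, h⟩
    rwa [← IsFractionRing.injective R K h]
  · exact fun h => ⟨x, h, rfl⟩

/-- The `t`-closure of an ideal consists of elements of `R`, so its closedness can be tested in `R`. -/
theorem isTIdeal_iff [IsDomain R] [IsFractionRing R K] {I : Ideal R} :
    IsTIdeal K I ↔ I ≠ ⊥ ∧
      ∀ x : R, algebraMap R K x ∈ tClosure (IsLocalization.coeSubmodule K I) → x ∈ I := by
  refine and_congr_right fun _ => ⟨fun h x hx => ?_, fun h => le_antisymm ?_ (le_tClosure _)⟩
  · rw [h] at hx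
    exact algebraMap_mem_coeSubmodule.1 hx
  · intro x hx
    obtain ⟨r, rfl⟩ := Submodule.mem_one.1 (tClosure_le_one (coeSubmodule_le_one I) hx)
    exact algebraMap_mem_coeSubmodule.2 (h r hx)

/-- Since `t`-closure is of finite type, Zorn's lemma applies to proper `t`-ideals. -/
theorem IsTIdeal.exists_le_isTMaximal [IsDomain R] [IsFractionRing R K] {I : Ideal R}
    (hI : IsTIdeal K I) (h1 : I ≠ ⊤) : ∃ M, IsTMaximal K M ∧ I ≤ M := by
  have ih : ∀ c ⊆ {I : Ideal R | IsTIdeal K I ∧ I ≠ ⊤}, IsChain (· ≤ ·) c → ∀ y ∈ c,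
      ∃ ub ∈ {I : Ideal R | IsTIdeal K I ∧ I ≠ ⊤}, ∀ z ∈ c, z ≤ ub := by
    intro c hc hchain y hy
    refine ⟨sSup c, ⟨isTIdeal_iff.2 ⟨?_, ?_⟩, ?_⟩, fun z hz => le_sSup hz⟩
    · exact fun h => (hc hy).1.1 (le_bot_iff.1 (h ▸ le_sSup hy))
    · rintro x ⟨J, hJ, hJc, hx⟩
      have hsub : ∃ z ∈ c, J ≤ IsLocalization.coeSubmodule K z := by
        clear hx
        induction J, hJ using Submodule.fg_induction with
        | singleton w =>
          obtain ⟨r, hr, rfl⟩ := hJc (Submodule.mem_span_singleton_self w)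
          obtain ⟨z, hz, hrz⟩ := (Submodule.mem_sSup_of_directed ⟨y, hy⟩ hchain.directedOn).1 hr
          exact ⟨z, hz, (Submodule.span_singleton_le_iff_mem _ _).2 ⟨r, hrz, rfl⟩⟩
        | sup J₁ J₂ _ _ ih₁ ih₂ =>
          obtain ⟨z₁, hz₁, h₁⟩ := ih₁ (le_sup_left.trans hJc)
          obtain ⟨z₂, hz₂, h₂⟩ := ih₂ (le_sup_right.trans hJc)
          obtain ⟨z, hz, hl₁, hl₂⟩ := hchain.directedOn z₁ hz₁ z₂ hz₂
          exact ⟨z, hz, sup_le (h₁.trans (IsLocalization.coeSubmodule_mono K hl₁))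
            (h₂.trans (IsLocalization.coeSubmodule_mono K hl₂))⟩
      obtain ⟨z, hz, hJz⟩ := hsub
      exact le_sSup hz ((isTIdeal_iff.1 (hc hz).1).2 x ⟨J, hJ, hJz, hx⟩)
    · rw [Ideal.ne_top_iff_one]
      intro h
      obtain ⟨z, hz, h1z⟩ := (Submodule.mem_sSup_of_directed ⟨y, hy⟩ hchain.directedOn).1 h
      exact (hc hz).2 ((Ideal.eq_top_iff_one _).2 h1z)
  obtain ⟨M, hIM, hM⟩ := zorn_le_nonempty₀ _ ih I ⟨hI, h1⟩
  exact ⟨M, hM, hIM⟩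

/-- A `t`-closed submodule of `K` is the intersection of its localizations at the `t`-maximal
ideals. -/
theorem mem_of_forall_isTMaximal [IsDomain R] [IsFractionRing R K] {F : Submodule R K}
    (hF : tClosure F = F) (hF0 : F ≠ ⊥) {x : K}
    (h : ∀ N : Ideal R, IsTMaximal K N → ∃ s ∉ N, s • x ∈ F) : x ∈ F := by
  -- the conductor `{r | r x ∈ F}` is a `t`-ideal contained in no `t`-maximal ideal
  let I : Ideal R := F.comap (LinearMap.toSpanSingleton R K x)
  have hmem : ∀ r, r ∈ I ↔ r • x ∈ F := fun r => Iff.rfl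
  have hI : IsTIdeal K I := by
    refine isTIdeal_iff.2 ⟨?_, fun r hr => ?_⟩
    · obtain ⟨f, hf, hf0⟩ := Submodule.exists_mem_ne_zero_of_ne_bot hF0
      obtain ⟨a, b, hb, rfl⟩ := IsFractionRing.div_surjective (A := R) f
      obtain ⟨c, d, hd, rfl⟩ := IsFractionRing.div_surjective (A := R) x
      have hb0 := IsFractionRing.to_map_ne_zero_of_mem_nonZeroDivisors (K := K) hb
      have hd0 := IsFractionRing.to_map_ne_zero_of_mem_nonZeroDivisors (K := K) hd
      have hda : d * a ∈ I := by
        rw [hmem]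
        convert F.smul_mem (c * b) hf using 1
        simp only [Algebra.smul_def, map_mul]
        field_simp
      intro hbot
      rw [hbot, Ideal.mem_bot] at hda
      rcases mul_eq_zero.1 hda with h | h
      · exact nonZeroDivisors.ne_zero hd h
      · exact hf0 (by rw [h, map_zero, zero_div])
    · rw [hmem, ← hF, Algebra.smul_def, mul_comm]
      refine mul_mem_tClosure ?_ hr
      rintro _ ⟨y, hy, rfl⟩
      have := (hmem y).1 hy
      rwa [Algebra.smul_def, mul_comm] at this
  have htop : I = ⊤ := by
    by_contra hne
    obtain ⟨N, hN, hIN⟩ := hI.exists_le_isTMaximal hne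
    obtain ⟨s, hs, hsx⟩ := h N hN
    exact hs (hIN hsx)
  have : (1 : R) ∈ I := htop ▸ Submodule.mem_top
  rwa [hmem, one_smul] at this

/-- `R` is the intersection of its localizations at the `t`-maximal ideals. -/
theorem exists_algebraMap_eq_of_forall_isTMaximal [IsDomain R] [IsFractionRing R K] {x : K}
    (h : ∀ N : Ideal R, IsTMaximal K N → ∃ s ∉ N, ∃ r, algebraMap R K s * x = algebraMap R K r) :
    ∃ r, x = algebraMap R K r := by
  have : x ∈ (1 : Submodule R K) := by
    refine mem_of_forall_isTMaximal tClosure_one ?_ fun N hN => ?_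
    · intro h
      have h1 : (1 : K) ∈ (1 : Submodule R K) := Submodule.one_le.1 le_rfl
      rw [h, Submodule.mem_bot] at h1
      exact one_ne_zero h1
    · obtain ⟨s, hs, r, hr⟩ := h N hN
      exact ⟨s, hs, Submodule.mem_one.2 ⟨r, by rw [Algebra.smul_def, hr]⟩⟩
  obtain ⟨r, hr⟩ := Submodule.mem_one.1 this
  exact ⟨r, hr.symm⟩

/-- If `R_P` is a valuation ring, an ideal contracted from `R_P` is a `t`-ideal: finitely generated
ideals are principal, hence divisorial, in `R_P`. -/
theorem IsValuationAt.isTIdeal [IsDomain R] [IsFractionRing R K] {P Q : Ideal R}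
    (hP : P.IsPrime) (hv : IsValuationAt P) (hQ : Q ≠ ⊥)
    (hsat : ∀ s ∉ P, ∀ x, s * x ∈ Q → x ∈ Q) : IsTIdeal K Q := by
  refine isTIdeal_iff.2 ⟨hQ, ?_⟩
  rintro x ⟨J, hJ, hJQ, hx⟩
  obtain ⟨b', hb', u, hu, h⟩ := hv.exists_generator hP hJ
  obtain ⟨b, hb, rfl⟩ := hJQ hb'
  rw [Algebra.linearMap_apply] at *
  rw [vClosure, Submodule.mem_div_iff_forall_mul_mem] at hx
  by_cases hb0 : b = 0
  · -- here `J = 0`, and `1 / J` is all of `K`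
    have hall : ∀ y : K, algebraMap R K x * y ∈ (1 : Submodule R K) := by
      refine fun y => hx y ?_
      rw [Submodule.mem_div_iff_forall_mul_mem]
      intro j hj
      obtain ⟨r, hr⟩ := h j hj
      rw [hb0, map_zero, smul_zero, Algebra.smul_def] at hr
      have hu0 : algebraMap R K u ≠ 0 := by
        rw [Ne, FaithfulSMul.algebraMap_eq_zero_iff]
        rintro rfl
        exact hu P.zero_mem
      rw [(mul_eq_zero.1 hr).resolve_left hu0, mul_zero]
      exact zero_mem _
    by_cases hx0 : x = 0
    · exact hx0 ▸ Q.zero_mem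
    obtain ⟨q, hq, hq0⟩ := Submodule.exists_mem_ne_zero_of_ne_bot hQ
    have hq0' : algebraMap R K q ≠ 0 := by rwa [Ne, FaithfulSMul.algebraMap_eq_zero_iff]
    have hx0' : algebraMap R K x ≠ 0 := by rwa [Ne, FaithfulSMul.algebraMap_eq_zero_iff]
    obtain ⟨r, hr⟩ := Submodule.mem_one.1 (hall (algebraMap R K q)⁻¹)
    have : x = r * q := by
      apply IsFractionRing.injective R K
      rw [map_mul, hr]
      field_simp
    exact this ▸ Q.mul_mem_left r hq
  · have hb0' : algebraMap R K b ≠ 0 := by rwa [Ne, FaithfulSMul.algebraMap_eq_zero_iff]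
    have := hx (algebraMap R K u / algebraMap R K b) (by
      rw [Submodule.mem_div_iff_forall_mul_mem]
      intro j hj
      obtain ⟨r, hr⟩ := h j hj
      refine Submodule.mem_one.2 ⟨r, ?_⟩
      simp only [Algebra.smul_def] at hr
      field_simp
      exact hr.symm)
    obtain ⟨r, hr⟩ := Submodule.mem_one.1 this
    refine hsat u hu x ?_
    have : u * x = r * b := by
      apply IsFractionRing.injective R K
      rw [map_mul, map_mul, hr]
      field_simp
    exact this ▸ Q.mul_mem_left r hb

theorem IsPvMD.isValuationAt [IsDomain R] [IsFractionRing R K] (hR : IsPvMD R K) {M : Ideal R}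
    (hM : IsTMaximal K M) : IsValuationAt M := by
  have := hM.isPrime
  have := hR M hM
  exact isValuationAt_of_valuationRing M

end TMaximal

/-! ### Sharp primes -/

section PvMD

variable {R : Type u} [CommRing R] [IsDomain R] {K : Type v} [Field K] [Algebra R K]
  [IsFractionRing R K]

theorem mem_localizationInter {S : Set (PrimeSpectrum R)} {x : K} :
    x ∈ localizationInter K S ↔
      ∀ P ∈ S, ∃ s ∉ P.asIdeal, ∃ r, algebraMap R K s * x = algebraMap R K r := by
  simp only [localizationInter, Algebra.mem_iInf]
  refine forall₂_congr fun P _ => ?_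
  constructor
  · rintro ⟨a, s, hs, rfl⟩
    have hs0 : algebraMap R K s ≠ 0 := by
      rw [Ne, FaithfulSMul.algebraMap_eq_zero_iff]
      rintro rfl
      exact hs P.asIdeal.zero_mem
    exact ⟨s, hs, a, by field_simp⟩
  · rintro ⟨s, hs, a, h⟩
    have hs0 : algebraMap R K s ≠ 0 := by
      rw [Ne, FaithfulSMul.algebraMap_eq_zero_iff]
      rintro rfl
      exact hs P.asIdeal.zero_mem
    refine ⟨a, s, hs, ?_⟩
    rw [← h]
    field_simp

theorem IsTPrime.exists_le_isTMaximal {P : Ideal R} (hP : IsTPrime K P) :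
    ∃ M, IsTMaximal K M ∧ P ≤ M :=
  hP.1.exists_le_isTMaximal hP.2.ne_top

theorem IsTPrime.isValuationAt (hR : IsPvMD R K) {P : Ideal R} (hP : IsTPrime K P) :
    IsValuationAt P := by
  obtain ⟨M, hM, hPM⟩ := hP.exists_le_isTMaximal
  exact (hR.isValuationAt hM).mono hPM

theorem IsTMaximal.isTPrime {M : Ideal R} (hM : IsTMaximal K M) : IsTPrime K M :=
  ⟨hM.1.1, hM.isPrime⟩

variable (K) in
/-- `P` is separated from the `t`-maximal ideals not containing it: `R_P` does not contain the
intersection of the `R_N` over the `t`-maximal ideals `N` that do not contain `P`. -/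
def IsSharpPrime (P : Ideal R) : Prop :=
  ∃ y : K, (∀ N : Ideal R, IsTMaximal K N → ¬ P ≤ N →
      ∃ s ∉ N, ∃ r, algebraMap R K s * y = algebraMap R K r) ∧
    ¬ ∃ s ∉ P, ∃ r, algebraMap R K s * y = algebraMap R K r

/-- A separating element `y` for `P` can be traded for a finitely generated ideal inside `P`:
the conductor of `y` is the inverse of the `t`-invertible module `R + R y`, so it is the
`t`-closure of a finitely generated ideal. -/
theorem IsSharpPrime.exists_fg (hR : IsPvMD R K) {P : Ideal R} (hy : IsSharpPrime K P) :
    ∃ I : Ideal R, I.FG ∧ I ≤ P ∧ ∀ N, IsTMaximal K N → I ≤ N → P ≤ N := by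
  obtain ⟨y, hyN, hyP⟩ := hy
  -- `H` is the conductor of `y`, and `C = H + H y` is the product of `H` and `R + R y`
  let H : Ideal R := (1 : Submodule R K).comap (LinearMap.toSpanSingleton R K y)
  have hH : ∀ h, h ∈ H ↔ ∃ r, algebraMap R K h * y = algebraMap R K r := by
    intro h
    change h • y ∈ (1 : Submodule R K) ↔ _
    rw [Submodule.mem_one, Algebra.smul_def]
    exact exists_congr fun _ => eq_comm
  let C : Submodule R K :=
    IsLocalization.coeSubmodule K H ⊔ Submodule.map (LinearMap.toSpanSingleton R K y) H
  have hC1 : C ≤ 1 := by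
    refine sup_le (coeSubmodule_le_one H) ?_
    rintro _ ⟨h, hh, rfl⟩
    exact hh
  have hC : tClosure C = 1 := by
    refine le_antisymm (tClosure_le_one hC1) (Submodule.one_le.2 ?_)
    refine mem_of_forall_isTMaximal (tClosure_tClosure C) ?_ fun N hN => ?_
    · obtain ⟨a, b, hb, hab⟩ := IsFractionRing.div_surjective (A := R) y
      have hb0 := IsFractionRing.to_map_ne_zero_of_mem_nonZeroDivisors (K := K) hb
      have hbC : algebraMap R K b ∈ tClosure C := le_tClosure C <| Submodule.mem_sup_left
        (algebraMap_mem_coeSubmodule.2 ((hH b).2 ⟨a, by rw [← hab]; field_simp⟩))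
      intro h
      rw [h, Submodule.mem_bot] at hbC
      exact hb0 hbC
    · obtain ⟨b, hb, u, hu, h⟩ := (hR.isValuationAt hN).exists_generator hN.isPrime
        (J := Submodule.span R {1, y}) (Submodule.fg_span (by simp))
      refine ⟨u, hu, le_tClosure C ?_⟩
      obtain ⟨r, hr⟩ := h 1 (Submodule.subset_span (by simp))
      obtain ⟨q, hq⟩ := h y (Submodule.subset_span (by simp))
      obtain ⟨c, d, rfl⟩ := Submodule.mem_span_pair.1 hb
      rw [hr]
      -- `r = u / b` lies in `H`, hence `u = r b` lies in `H + H y`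
      have hrH : r ∈ H := by
        rw [hH]
        have hu0 : algebraMap R K u ≠ 0 := by
          rw [Ne, FaithfulSMul.algebraMap_eq_zero_iff]
          rintro rfl
          exact hu N.zero_mem
        refine ⟨q, mul_left_cancel₀ hu0 ?_⟩
        simp only [Algebra.smul_def] at hr hq
        linear_combination (algebraMap R K r) * hq - (algebraMap R K q) * hr
      rw [smul_add, smul_smul, smul_smul, mul_comm r d]
      refine add_mem (Submodule.mem_sup_left ⟨r * c, H.mul_mem_right c hrH, ?_⟩)
        (Submodule.mem_sup_right ⟨d * r, H.mul_mem_left d hrH, rfl⟩)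
      rw [Algebra.linearMap_apply, Algebra.algebraMap_eq_smul_one]
  have h1 : (1 : K) ∈ tClosure C := hC ▸ Submodule.one_le.1 le_rfl
  obtain ⟨J, hJ, hJC, h1J⟩ := h1
  have hsub : ∃ I : Ideal R, I.FG ∧ I ≤ H ∧
      J ≤ IsLocalization.coeSubmodule K I ⊔
        Submodule.map (LinearMap.toSpanSingleton R K y) I := by
    clear h1J
    induction J, hJ using Submodule.fg_induction with
    | singleton w =>
      obtain ⟨_, ⟨a, ha, rfl⟩, _, ⟨b, hb, rfl⟩, rfl⟩ :=
        Submodule.mem_sup.1 (hJC (Submodule.mem_span_singleton_self w))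
      refine ⟨Ideal.span {a, b}, Submodule.fg_span (by simp), ?_, ?_⟩
      · rw [Ideal.span_le]
        rintro x (rfl | rfl)
        exacts [ha, hb]
      · rw [Submodule.span_singleton_le_iff_mem]
        exact add_mem (Submodule.mem_sup_left ⟨a, Ideal.subset_span (by simp), rfl⟩)
          (Submodule.mem_sup_right ⟨b, Ideal.subset_span (by simp), rfl⟩)
    | sup J₁ J₂ _ _ ih₁ ih₂ =>
      obtain ⟨I₁, hI₁, hH₁, h₁⟩ := ih₁ (le_sup_left.trans hJC)
      obtain ⟨I₂, hI₂, hH₂, h₂⟩ := ih₂ (le_sup_right.trans hJC)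
      refine ⟨I₁ ⊔ I₂, Submodule.FG.sup hI₁ hI₂, sup_le hH₁ hH₂, sup_le (h₁.trans ?_) (h₂.trans ?_)⟩
      · exact sup_le_sup (IsLocalization.coeSubmodule_mono K le_sup_left)
          (Submodule.map_mono le_sup_left)
      · exact sup_le_sup (IsLocalization.coeSubmodule_mono K le_sup_right)
          (Submodule.map_mono le_sup_right)
  obtain ⟨I, hI, hIH, hJI⟩ := hsub
  refine ⟨I, hI, fun h hh => ?_, fun N hN hIN => ?_⟩
  · by_contra hhP
    exact hyP ⟨h, hhP, (hH h).1 (hIH hh)⟩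
  · by_contra hPN
    obtain ⟨s, hs, r, hr⟩ := hyN N hN hPN
    -- otherwise `J ⊆ I + I y` lies in `N`, although `J_v = R`
    have hJN : J ≤ IsLocalization.coeSubmodule K N := by
      intro j hj
      obtain ⟨j, rfl⟩ := Submodule.mem_one.1 (hC1 (hJC hj))
      obtain ⟨_, ⟨a, ha, rfl⟩, _, ⟨b, hb, rfl⟩, hab⟩ := Submodule.mem_sup.1 (hJI hj)
      rw [algebraMap_mem_coeSubmodule]
      have : s * j = s * a + b * r := by
        apply IsFractionRing.injective R K
        rw [LinearMap.toSpanSingleton_apply, Algebra.smul_def, Algebra.linearMap_apply] at hab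
        simp only [map_mul, map_add]
        rw [← hab, ← hr]
        ring
      refine (hN.isPrime.mem_or_mem ?_).resolve_left hs
      rw [this]
      exact add_mem (N.mul_mem_left _ (hIN ha)) (N.mul_mem_right _ (hIN hb))
    have : (1 : R) ∈ N := (isTIdeal_iff.1 hN.1.1).2 1 ⟨J, hJ, hJN, by rwa [map_one]⟩
    exact hN.isPrime.one_notMem this

/-- Under the `t##`-property the antichains of `t`-maximal ideals not containing `P`, with and
without `P` added, have different intersections. -/
theorem IsTSharpSharp.isSharpPrime (h : IsTSharpSharp R K) {P : Ideal R}
    (hP : IsTPrime K P) : IsSharpPrime K P := by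
  by_contra hcon
  let S : Set (PrimeSpectrum R) := {N | IsTMaximal K N.asIdeal ∧ ¬ P ≤ N.asIdeal}
  let p : PrimeSpectrum R := ⟨P, hP.2⟩
  have hSt : S ⊆ tSpec R K := fun N hN => hN.1.isTPrime
  have hS : IsAntichain (· ≤ ·) S := by
    intro N hN N' hN' hne hle
    exact hne (le_antisymm hle (hN.1.2 hN'.1.1 hle))
  refine h (insert p S) S (Set.insert_subset hP hSt) hSt ?_ hS ?_ ?_
  · refine hS.insert (fun N hN _ hle => ?_) (fun N hN _ hle => hN.2 hle)
    exact hN.2 (hN.1.2 ⟨hP.1, hP.2.ne_top⟩ hle)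
  · intro heq
    have : p ∈ S := heq ▸ Set.mem_insert p S
    exact this.2 le_rfl
  · ext x
    rw [mem_localizationInter, mem_localizationInter]
    refine ⟨fun hx N hN => hx N (Set.mem_insert_of_mem _ hN), fun hx N hN => ?_⟩
    rcases hN with rfl | hN
    · by_contra hxP
      exact hcon ⟨x, fun N hN hPN => hx ⟨N, hN.isPrime⟩ ⟨hN, hPN⟩, hxP⟩
    · exact hx N hN

end PvMD

/-! ### Strong ideals -/

section Strong

variable {R : Type u} [CommRing R] {K : Type v} [Field K] [Algebra R K]
  [IsFractionRing R K]

/-- The colon `(R : J)` of a strong ideal `J` stabilizes `J`. -/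
theorem IsStrong.exists_mem_eq {J : Ideal R} (hJ : IsStrong J) {z : K}
    (hz : ∀ j ∈ J, ∃ r, z * algebraMap R K j = algebraMap R K r) {j : R} (hj : j ∈ J) :
    ∃ r ∈ J, z * algebraMap R K j = algebraMap R K r := by
  obtain ⟨M, _, _, rfl⟩ := hJ
  refine Submodule.span_induction ?_ ⟨0, zero_mem _, by simp⟩ ?_ ?_ hj
  · rintro _ ⟨f, m, rfl⟩
    have hf : ∀ m, ∃ r, z * algebraMap R K (f m) = algebraMap R K r :=
      fun m => hz _ (Ideal.subset_span ⟨f, m, rfl⟩)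
    choose g hg using hf
    let g' : M →ₗ[R] R :=
      { toFun := g
        map_add' := fun x y => IsFractionRing.injective R K (by
          rw [map_add, ← hg, ← hg, ← hg, map_add, map_add, mul_add])
        map_smul' := fun r x => IsFractionRing.injective R K (by
          rw [RingHom.id_apply, smul_eq_mul, map_mul, ← hg, ← hg, map_smul, smul_eq_mul, map_mul]
          ring) }
    exact ⟨g m, Ideal.subset_span ⟨g', m, rfl⟩, hg m⟩
  · rintro x y _ _ ⟨r, hr, hr'⟩ ⟨s, hs, hs'⟩
    exact ⟨r + s, add_mem hr hs, by rw [map_add, map_add, mul_add, hr', hs']⟩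
  · rintro a x _ ⟨r, hr, hr'⟩
    refine ⟨a * r, Ideal.mul_mem_left _ _ hr, ?_⟩
    rw [smul_eq_mul, map_mul, map_mul, mul_left_comm, hr']

/-- A nonzero ideal stabilized by its colon `(R : J)` is its own trace, because every `R`-linear
map `J → R` is multiplication by an element of `K`. -/
theorem isStrong_of_forall_mem {J : Ideal R} (hJ0 : J ≠ ⊥)
    (h : ∀ z : K, (∀ j ∈ J, ∃ r, z * algebraMap R K j = algebraMap R K r) →
      ∀ j ∈ J, ∀ r, z * algebraMap R K j = algebraMap R K r → r ∈ J) : IsStrong J := by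
  refine ⟨J, inferInstance, inferInstance, le_antisymm (Ideal.span_le.2 ?_) fun j hj => ?_⟩
  · rintro _ ⟨f, m, rfl⟩
    obtain ⟨c, hc, hc0⟩ := Submodule.exists_mem_ne_zero_of_ne_bot hJ0
    have hc0' : algebraMap R K c ≠ 0 := by rwa [Ne, FaithfulSMul.algebraMap_eq_zero_iff]
    have key : ∀ j : J,
        algebraMap R K (f ⟨c, hc⟩) / algebraMap R K c * algebraMap R K j =
          algebraMap R K (f j) := by
      intro j
      have : c * f j = j * f ⟨c, hc⟩ := by
        rw [← smul_eq_mul, ← smul_eq_mul, ← map_smul, ← map_smul]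
        congr 1
        exact Subtype.ext (mul_comm _ _)
      have := congrArg (algebraMap R K) this
      rw [map_mul, map_mul] at this
      field_simp
      linear_combination -this
    exact h _ (fun j hj => ⟨_, key ⟨j, hj⟩⟩) m m.2 _ (key m)
  · exact Ideal.subset_span ⟨J.subtype, ⟨j, hj⟩, rfl⟩

end Strong

/-! ### Strong `t`-ideals under the `t##`-property -/

section MinimalPrime

variable {R : Type u} [CommRing R]

/-- If `P` is a minimal prime of `J`, then `P R_P` is the radical of `J R_P`. -/
theorem exists_mul_pow_mem_of_mem_minimalPrimes {J P : Ideal R} (hP : P ∈ J.minimalPrimes)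
    {x : R} (hx : x ∈ P) : ∃ s ∉ P, ∃ n : ℕ, s * x ^ n ∈ J := by
  by_contra! hcon
  have := hP.1.1
  have hdisj : Disjoint (J : Set R) (P.primeCompl ⊔ Submonoid.powers x : Submonoid R) := by
    rw [Set.disjoint_left]
    intro a ha ha'
    obtain ⟨s, hs, _, ⟨n, rfl⟩, rfl⟩ := Submonoid.mem_sup.1 ha'
    exact hcon s hs n ha
  obtain ⟨q, hq, hJq, hqd⟩ := Ideal.exists_le_prime_disjoint J _ hdisj
  rw [Set.disjoint_left] at hqd
  have hqP : q ≤ P := by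
    intro a ha
    by_contra haP
    exact hqd ha (Submonoid.mem_sup_left haP)
  exact hqd (hP.2 ⟨hq, hJq⟩ hqP hx) (Submonoid.mem_sup_right (Submonoid.mem_powers x))

end MinimalPrime

section Main

variable {R : Type u} [CommRing R] {K : Type v} [Field K] [Algebra R K] [IsFractionRing R K]

variable (K) in
/-- If `u B ⊆ b R` and `B` meets the complement of the prime `Q`, then `u / b` lies in `R_Q`. -/
theorem exists_mul_div_eq {Q B : Ideal R} {b u : R} (hb : b ≠ 0) (h : ∀ j ∈ B, b ∣ u * j)
    (hBQ : ¬ B ≤ Q) :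
    ∃ s ∉ Q, ∃ r, algebraMap R K s * (algebraMap R K u / algebraMap R K b) =
      algebraMap R K r := by
  obtain ⟨i, hi, hiQ⟩ := SetLike.not_le_iff_exists.1 hBQ
  obtain ⟨r, hr⟩ := h i hi
  have hb' : algebraMap R K b ≠ 0 := by rwa [Ne, FaithfulSMul.algebraMap_eq_zero_iff]
  refine ⟨i, hiQ, r, ?_⟩
  have := congrArg (algebraMap R K) hr
  rw [map_mul, map_mul] at this
  field_simp
  linear_combination this

variable [IsDomain R]

/-- A strong ideal `J` of a P`v`MD has `J R_P = P R_P` at each of its minimal primes `P` that is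
a sharp `t`-prime: otherwise, some finitely generated `B ⊆ P` would locally contain `J`, so that
the powers of a local generator `z` of `B⁻¹` stabilize `J`, and `J R_P` would be contained in all
powers of `B R_P`. -/
theorem IsStrong.exists_mul_mem_of_mem_minimalPrimes (hR : IsPvMD R K) {J P : Ideal R}
    (hJ : IsStrong J) (hP : P ∈ J.minimalPrimes) (hPt : IsTPrime K P)
    (hsharp : IsSharpPrime K P) {x : R} (hx : x ∈ P) : ∃ s ∉ P, s * x ∈ J := by
  by_contra! hcon
  obtain ⟨I, hI, hIP, hIN⟩ := hsharp.exists_fg hR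
  have hx0 : x ≠ 0 := by
    rintro rfl
    exact hcon 1 hPt.2.one_notMem (by simp)
  have hxB : x ∈ I ⊔ Ideal.span {x} :=
    Ideal.mem_sup_right (Ideal.mem_span_singleton_self x)
  obtain ⟨b, hb, u, hu, hub⟩ := (hPt.isValuationAt hR).exists_generator_ideal hPt.2
    (B := I ⊔ Ideal.span {x}) (Submodule.FG.sup hI (Submodule.fg_span_singleton x))
  have hbP : b ∈ P :=
    sup_le hIP ((Ideal.span_singleton_le_iff_mem P).2 hx) hb
  obtain ⟨q, hq⟩ := hub x hxB
  have hb0 : b ≠ 0 := by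
    rintro rfl
    rw [zero_mul] at hq
    rcases mul_eq_zero.1 hq with h | h
    · exact hu (h ▸ P.zero_mem)
    · exact hx0 h
  have hb0' : algebraMap R K b ≠ 0 := by rwa [Ne, FaithfulSMul.algebraMap_eq_zero_iff]
  set z : K := algebraMap R K u / algebraMap R K b with hz
  have hzJ : ∀ j ∈ J, ∃ r, z * algebraMap R K j = algebraMap R K r := by
    intro j hj
    refine exists_algebraMap_eq_of_forall_isTMaximal fun N hN => ?_
    by_cases hPN : P ≤ N
    · -- `J R_N ⊆ x R_N`, since `x ∉ J R_P`
      have hdvd : ∃ t ∉ N, x ∣ t * j := by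
        rcases hR.isValuationAt hN x j with h | ⟨t, ht, r, hr⟩
        · exact h
        · exact absurd (hr ▸ J.mul_mem_right r hj) (hcon t fun h => ht (hPN h))
      obtain ⟨t, ht, r, hr⟩ := hdvd
      refine ⟨t, ht, q * r, ?_⟩
      have h₁ := congrArg (algebraMap R K) hq
      have h₂ := congrArg (algebraMap R K) hr
      rw [map_mul, map_mul] at h₁ h₂
      rw [hz, map_mul]
      field_simp
      linear_combination (algebraMap R K u) * h₂ + (algebraMap R K r) * h₁
    · obtain ⟨s, hs, r, hr⟩ := exists_mul_div_eq K hb0 (fun i hi => hub i hi)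
        (fun h => hPN (hIN N hN (le_sup_left.trans h)))
      exact ⟨s, hs, r * j, by rw [← mul_assoc, hr, map_mul]⟩
  have hpow : ∀ n : ℕ, ∀ j ∈ J, ∃ r ∈ J, z ^ n * algebraMap R K j = algebraMap R K r := by
    intro n
    induction n with
    | zero => exact fun j hj => ⟨j, hj, by simp⟩
    | succ n ih =>
      intro j hj
      obtain ⟨r, hr, hr'⟩ := ih j hj
      obtain ⟨r', h, h'⟩ := hJ.exists_mem_eq hzJ hr
      exact ⟨r', h, by rw [pow_succ', mul_assoc, hr', h']⟩
  obtain ⟨s, hs, n, hsn⟩ := exists_mul_pow_mem_of_mem_minimalPrimes hP hbP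
  obtain ⟨r, hr, hr'⟩ := hpow n _ hsn
  have : s * u ^ n = r := by
    apply IsFractionRing.injective R K
    rw [← hr', hz, map_mul, map_mul, map_pow, map_pow, div_pow]
    field_simp
  exact hPt.2.mul_notMem hs (fun h => hu (hPt.2.mem_of_pow_mem n h)) (this ▸ hP.1.2 hr)

/-- If all `t`-primes are sharp, a strong `t`-ideal `J` is radical. At a `t`-maximal ideal `M`
above a minimal prime `P` of `J` one has `J R_P = P R_P = P R_M`, and the colon `(R : J)`
generates `R_P` over `R_M`, so `J R_M` is an ideal of `R_P`. -/
theorem isTRTP_of_forall_isSharpPrime (hR : IsPvMD R K)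
    (h : ∀ P : Ideal R, IsTPrime K P → IsSharpPrime K P) : IsTRTP R K := by
  intro J hJt hJ _ x hxJ
  rw [← algebraMap_mem_coeSubmodule (K := K)]
  have hJ0 : IsLocalization.coeSubmodule K J ≠ ⊥ := by
    intro h
    obtain ⟨j, hj, hj0⟩ := Submodule.exists_mem_ne_zero_of_ne_bot hJt.1
    have hjK : algebraMap R K j ∈ IsLocalization.coeSubmodule K J := ⟨j, hj, rfl⟩
    rw [h, Submodule.mem_bot, FaithfulSMul.algebraMap_eq_zero_iff] at hjK
    exact hj0 hjK
  refine mem_of_forall_isTMaximal hJt.2 hJ0 fun M hM => ?_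
  suffices ∃ s ∉ M, s * x ∈ J by
    obtain ⟨s, hs, hsx⟩ := this
    refine ⟨s, hs, ?_⟩
    rwa [Algebra.smul_def, ← map_mul, algebraMap_mem_coeSubmodule]
  by_cases hJM : J ≤ M
  swap
  · obtain ⟨j, hj, hjM⟩ := SetLike.not_le_iff_exists.1 hJM
    exact ⟨j, hjM, J.mul_mem_right x hj⟩
  have := hM.isPrime
  obtain ⟨P, hP, hPM⟩ := Ideal.exists_minimalPrimes_le hJM
  have hPp : P.IsPrime := hP.1.1
  have hMv := hR.isValuationAt hM
  have hPt : IsTPrime K P := by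
    refine ⟨(hMv.mono hPM).isTIdeal hPp ?_ fun s hs y hy => (hPp.mem_or_mem hy).resolve_left hs,
      hPp⟩
    intro hbot
    exact hJt.1 (le_bot_iff.1 (hbot ▸ hP.1.2))
  have hxP : x ∈ P := hPp.radical_le_iff.2 hP.1.2 hxJ
  obtain ⟨s, hsP, hsx⟩ := hJ.exists_mul_mem_of_mem_minimalPrimes hR hP hPt (h P hPt) hxP
  obtain ⟨I, hI, hIP, hIN⟩ := (h P hPt).exists_fg hR
  -- the colon `(R : I + R s)` lies in `(R : J)` and generates `s⁻¹ R_M` at `M`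
  have hsC : s ∈ I ⊔ Ideal.span {s} :=
    Ideal.mem_sup_right (Ideal.mem_span_singleton_self s)
  obtain ⟨c, hc, u, hu, huc⟩ := hMv.exists_generator_ideal hM.isPrime
    (B := I ⊔ Ideal.span {s}) (Submodule.FG.sup hI (Submodule.fg_span_singleton s))
  obtain ⟨r, hr⟩ := huc s hsC
  have hs0 : s ≠ 0 := fun h => hsP (h ▸ P.zero_mem)
  have hu0 : u ≠ 0 := fun h => hu (h ▸ M.zero_mem)
  have hc0 : c ≠ 0 := by
    rintro rfl
    rw [zero_mul] at hr
    exact mul_ne_zero hu0 hs0 hr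
  have hc0' : algebraMap R K c ≠ 0 := by rwa [Ne, FaithfulSMul.algebraMap_eq_zero_iff]
  set z : K := algebraMap R K u / algebraMap R K c with hz
  have hzs : z * algebraMap R K s = algebraMap R K r := by
    have h₁ := congrArg (algebraMap R K) hr
    rw [map_mul, map_mul] at h₁
    rw [hz]
    field_simp
    linear_combination h₁
  have hzJ : ∀ j ∈ J, ∃ r, z * algebraMap R K j = algebraMap R K r := by
    intro j hj
    refine exists_algebraMap_eq_of_forall_isTMaximal fun N hN => ?_
    by_cases hPN : P ≤ N
    · obtain ⟨t, ht, q, hq⟩ :=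
        (hR.isValuationAt hN).exists_dvd_mul hPp hPN hsP (hP.1.2 hj)
      refine ⟨t, ht, r * q, ?_⟩
      have h₂ := congrArg (algebraMap R K) hq
      rw [map_mul, map_mul] at h₂
      rw [map_mul, ← hzs]
      linear_combination z * h₂
    · obtain ⟨t, ht, q, hq⟩ := exists_mul_div_eq K hc0 (fun i hi => huc i hi)
        (fun h => hPN (hIN N hN (le_sup_left.trans h)))
      exact ⟨t, ht, q * j, by rw [← mul_assoc, hq, map_mul]⟩
  obtain ⟨y, hy, hy'⟩ := hJ.exists_mem_eq hzJ hsx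
  have hyr : y = r * x := by
    apply IsFractionRing.injective R K
    rw [← hy', map_mul, map_mul, ← hzs, mul_assoc]
  refine ⟨r, fun hrM => ?_, hyr ▸ hy⟩
  -- `c ∈ I + R s` is a multiple of `s` in `R_M`, since `I ⊆ P`; so `r = u s / c` is a unit there
  obtain ⟨i, hi, _, hd, rfl⟩ := Submodule.mem_sup.1 hc
  obtain ⟨d, rfl⟩ := Ideal.mem_span_singleton'.1 hd
  obtain ⟨v, hv, w, hw⟩ := hMv.exists_dvd_mul hPp hPM hsP (hIP hi)
  have : u * v = r * (w + v * d) := by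
    apply mul_left_cancel₀ hs0
    linear_combination v * hr + r * hw
  exact hM.isPrime.mul_notMem hu hv (this ▸ M.mul_mem_right _ hrM)

/-! ### Branched `t`-primes under the `t`-radical trace property -/

/-- A branched `t`-prime `P` is sharp in the presence of the `t`-radical trace property. Otherwise
a `P`-primary ideal `Q` satisfies `(R : Q) ⊆ ⋂ R_N ⊆ R_P`, where `N` ranges over the `t`-maximal
ideals not containing `P`, and so `Q` is a strong `t`-ideal. -/
theorem IsTRTP.isSharpPrime (h : IsTRTP R K) (hR : IsPvMD R K) {P : Ideal R} (hP : IsTPrime K P)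
    (hb : IsBranched P) : IsSharpPrime K P := by
  by_contra hcon
  obtain ⟨Q, hQ, hQP, hne⟩ := hb
  have hsat : ∀ s ∉ P, ∀ x, s * x ∈ Q → x ∈ Q := by
    intro s hs x hx
    rw [mul_comm] at hx
    exact ((Ideal.isPrimary_iff.1 hQ).2 hx).resolve_right (hQP ▸ hs)
  have hQ0 : Q ≠ ⊥ := by
    rintro rfl
    exact hP.1.1 (hQP ▸ Ideal.radical_bot_of_isReduced)
  have hQt : IsTIdeal K Q := (hP.isValuationAt hR).isTIdeal hP.2 hQ0 hsat
  have hstrong : IsStrong Q := by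
    refine isStrong_of_forall_mem (K := K) hQ0 fun z hz j hj r hr => ?_
    obtain ⟨s, hs, a, ha⟩ : ∃ s ∉ P, ∃ a, algebraMap R K s * z = algebraMap R K a := by
      by_contra hzP
      refine hcon ⟨z, fun N hN hPN => ?_, hzP⟩
      have hQN : ¬ Q ≤ N := fun hle => hPN (hQP ▸ hN.isPrime.radical_le_iff.2 hle)
      obtain ⟨q, hq, hqN⟩ := SetLike.not_le_iff_exists.1 hQN
      obtain ⟨r, hr⟩ := hz q hq
      exact ⟨q, hqN, r, by rw [mul_comm, hr]⟩
    refine hsat s hs r ?_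
    have : s * r = a * j := by
      apply IsFractionRing.injective R K
      rw [map_mul, map_mul, ← hr, ← ha, mul_assoc]
    exact this ▸ Q.mul_mem_left a hj
  have hQtop : Q ≠ ⊤ := hQ.ne_top
  exact hne ((h Q hQt hstrong hQtop).radical.symm.trans hQP)

/-- For a sharp branched `t`-prime `P`, the rings `R_Q` at `t`-primes `Q` not containing `P` have
a common element outside `R_P`. Branchedness provides an element of `P` that lies in no prime
properly contained in `P`. -/
theorem IsSharpPrime.exists_separating (hR : IsPvMD R K) {P : Ideal R} (hP : IsTPrime K P)
    (hs : IsSharpPrime K P) (hb : IsBranched P) :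
    ∃ z : K, (∀ Q : Ideal R, IsTPrime K Q → ¬ P ≤ Q →
      ∃ s ∉ Q, ∃ r, algebraMap R K s * z = algebraMap R K r) ∧
    ¬ ∃ s ∉ P, ∃ r, algebraMap R K s * z = algebraMap R K r := by
  obtain ⟨I, hI, hIP, hIN⟩ := hs.exists_fg hR
  obtain ⟨Q, hQ, hQP, hne⟩ := hb
  have hQle : Q ≤ P := hQP ▸ Ideal.le_radical
  obtain ⟨a, haP, haQ⟩ := SetLike.not_le_iff_exists.1 fun h => hne (le_antisymm hQle h)
  have hB : ∀ Q' : Ideal R, IsTPrime K Q' → I ⊔ Ideal.span {a} ≤ Q' → P ≤ Q' := by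
    intro Q' hQ' hle
    obtain ⟨N, hN, hQN⟩ := hQ'.exists_le_isTMaximal
    have hPN : P ≤ N := hIN N hN ((le_sup_left.trans hle).trans hQN)
    have haQ' : a ∈ Q' := hle (Ideal.mem_sup_right (Ideal.mem_span_singleton_self a))
    rw [← hQP, hQ'.2.radical_le_iff]
    intro q hq
    -- `a ∉ Q R_P`, so that `a` divides `q` in `R_N`
    rcases hR.isValuationAt hN a q with ⟨t, ht, r, hr⟩ | ⟨t, ht, r, hr⟩
    · have : t * q ∈ Q' := hr ▸ Q'.mul_mem_right r haQ'
      exact (hQ'.2.mem_or_mem this).resolve_left fun h => ht (hQN h)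
    · have : a * t ∈ Q := by
        rw [mul_comm, hr]
        exact Q.mul_mem_right r hq
      refine absurd (((Ideal.isPrimary_iff.1 hQ).2 this).resolve_right fun h => ht (hPN ?_)) haQ
      rwa [hQP] at h
  obtain ⟨b, hb, u, hu, hub⟩ := (hP.isValuationAt hR).exists_generator_ideal hP.2
    (B := I ⊔ Ideal.span {a}) (Submodule.FG.sup hI (Submodule.fg_span_singleton a))
  have hbP : b ∈ P :=
    sup_le hIP ((Ideal.span_singleton_le_iff_mem P).2 haP) hb
  have hb0 : b ≠ 0 := by
    rintro rfl
    obtain ⟨r, hr⟩ := hub a (Ideal.mem_sup_right (Ideal.mem_span_singleton_self a))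
    rw [zero_mul] at hr
    rcases mul_eq_zero.1 hr with h | h
    · exact hu (h ▸ P.zero_mem)
    · exact haQ (h ▸ Q.zero_mem)
  have hb0' : algebraMap R K b ≠ 0 := by rwa [Ne, FaithfulSMul.algebraMap_eq_zero_iff]
  refine ⟨algebraMap R K u / algebraMap R K b, fun Q' hQ' hPQ' => ?_, ?_⟩
  · exact exists_mul_div_eq K hb0 hub fun hle => hPQ' (hB Q' hQ' hle)
  · rintro ⟨s, hsP, r, hr⟩
    have : s * u = r * b := by
      apply IsFractionRing.injective R K
      rw [map_mul, map_mul, ← hr]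
      field_simp
    exact hP.2.mul_notMem hsP hu (this ▸ P.mul_mem_left r hbP)

theorem isTSharpSharp_of_forall_isSharpPrime (hR : IsPvMD R K)
    (h : ∀ P : Ideal R, IsTPrime K P → IsSharpPrime K P)
    (hb : ∀ P : Ideal R, IsTPrime K P → IsBranched P) : IsTSharpSharp R K := by
  intro S₁ S₂ hS₁ hS₂ ha₁ ha₂ hne heq
  have habove : ∀ S S' : Set (PrimeSpectrum R), S ⊆ tSpec R K → S' ⊆ tSpec R K →
      localizationInter K S = localizationInter K S' → ∀ P ∈ S, ∃ Q ∈ S', P ≤ Q := by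
    intro S S' hS hS' heq P hP
    by_contra! hcon
    obtain ⟨z, hz, hzP⟩ := (h _ (hS hP)).exists_separating hR (hS hP) (hb _ (hS hP))
    have : z ∈ localizationInter K S' :=
      mem_localizationInter.2 fun Q hQ => hz Q.asIdeal (hS' hQ) (hcon Q hQ)
    rw [← heq, mem_localizationInter] at this
    exact hzP (this P hP)
  have hsub : ∀ S S' : Set (PrimeSpectrum R), S ⊆ tSpec R K → S' ⊆ tSpec R K →
      IsAntichain (· ≤ ·) S → localizationInter K S = localizationInter K S' → S ⊆ S' := by
    intro S S' hS hS' ha heq P hP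
    obtain ⟨Q, hQ, hPQ⟩ := habove S S' hS hS' heq P hP
    obtain ⟨P', hP', hQP'⟩ := habove S' S hS' hS heq.symm Q hQ
    have hPP' : P = P' := ha.eq hP hP' (hPQ.trans hQP')
    rwa [le_antisymm hPQ (hPP' ▸ hQP')]
  exact hne (Set.Subset.antisymm (hsub S₁ S₂ hS₁ hS₂ ha₁ heq) (hsub S₂ S₁ hS₂ hS₁ ha₂ heq.symm))

end Main

end TIdeal

theorem mainTheorem2 (R : Type u) [CommRing R] [IsDomain R] (K : Type v) [Field K] [Algebra R K]
    [IsFractionRing R K] (hR : TIdeal.IsPvMD R K) :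
    (TIdeal.IsTSharpSharp R K → TIdeal.IsTRTP R K) ∧
      (TIdeal.IsTRTP R K → (∀ P : Ideal R, TIdeal.IsTPrime K P → TIdeal.IsBranched P) →
        TIdeal.IsTSharpSharp R K) :=
  ⟨fun h => TIdeal.isTRTP_of_forall_isSharpPrime hR fun _ hP => h.isSharpPrime hP,
    fun h hb => TIdeal.isTSharpSharp_of_forall_isSharpPrime hR
      (fun P hP => h.isSharpPrime hR hP (hb P hP)) hb⟩
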